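/- Rings are commutative with $1$. A polynomial $f\in R[X_1,\dots,X_n]$ represents a unit over an $R$-algebra $S$ if $f(s_1,\dots,s_n)\in S^\times$ for some $s_1,\dots,s_n\in S$. A ring $R$ is an LG-ring if, for every $n\in\mathbb N$, every $f\in R[X_1,\dots,X_n]$ that represents a unit over $R/\mathfrak m$ for each maximal ideal $\mathfrak m$ of $R$ represents a unit over $R$. A quadratic form over $R$ is a pair $(M,q)$ of a finitely generated projective $R$-module $M$ and a map $q\colon M\to R$ with $q(rm)=r^2q(m)$ for $r\in R$, $m\in M$, whose polar form $b_q(m,m')=q(m+m')-q(m)-q(m')$ is bilinear. It is regular if $M\to \operatorname{Hom}_R(M,R)$, $m\mapsto b_q(m,-)$, is bijective. Its radical is $\operatorname{rad}(q)=\{m\in M: q(m)=0 \text{ and } b_q(m,m')=0 \text{ for all } m'\in M\}$. For an $R$-algebra $T$, let $q_T$ be the unique quadratic form over $T$ on $M\otimes_R T$ with $q_T(m\otimes t)=q(m)t^2$; $q$ is nonsingular if $\operatorname{rad}(q_F)=0$ for all $R$-algebras $F$ that are fields. The orthogonal sum $q_1\perp q_2$ is the form $(m_1,m_2)\mapsto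 q_1(m_1)+q_2(m_2)$ on $M_1\oplus M_2$, and $q_1\cong q_2$ means that there is an $R$-linear isomorphism $f\colon M_1\to M_2$ with $q_2\circ f=q_1$. **Theorem (Witt cancellation).** Let $R$ be an LG-ring, let $q_1$ and $q_2$ be nonsingular quadratic forms over $R$, and let $q_3$ be a regular quadratic form over $R$. Then $$q_1\perp q_3\;\cong\; q_2\perp q_3\quad\Longrightarrow\quad q_1\cong q_2 .$$ (No assumption is made on the ranks, which may be odd or non-constant, nor on the characteristic; $2$ need not be invertible in $R$.) -/

import Mathlib

open scoped TensorProduct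

universe u v w

noncomputable section

namespace LGQuadratic

/-- For an `R`-algebra `S`, the polynomial `f ∈ R[X₁, …, Xₙ]` represents a unit over `S` if
`f(s₁, …, sₙ) ∈ Sˣ` for some `s₁, …, sₙ ∈ S`. -/
def RepresentsUnit {R : Type u} [CommRing R] (S : Type v) [CommRing S] [Algebra R S] {n : ℕ}
    (f : MvPolynomial (Fin n) R) : Prop :=
  ∃ s : Fin n → S, IsUnit (MvPolynomial.aeval s f)

/-- `R` is an LG-ring (local-global ring): a polynomial in finitely many variables represents a
unit over `R` if and only if it represents a unit over every residue field `R ⧸ 𝔪`, `𝔪` a maximal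
ideal of `R`. -/
def IsLGRing (R : Type u) [CommRing R] : Prop :=
  ∀ (n : ℕ) (f : MvPolynomial (Fin n) R),
    RepresentsUnit R f ↔ ∀ (m : Ideal R) [m.IsMaximal], RepresentsUnit (R ⧸ m) f

section BaseChange

variable {R : Type u} [CommRing R] {M : Type v} [AddCommGroup M] [Module R M]

/-- On a projective module every quadratic form is of the form `x ↦ B(x, x)` for some (not
necessarily symmetric) bilinear form `B`. -/
theorem exists_bilinForm [Module.Projective R M] (q : QuadraticForm R M) :
    ∃ B : LinearMap.BilinForm R M, LinearMap.BilinMap.toQuadraticMap B = q := by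
  obtain ⟨s, hs⟩ := Module.Projective.out (R := R) (P := M)
  obtain ⟨B, hB⟩ := LinearMap.BilinMap.toQuadraticMap_surjective
    (q.comp (Finsupp.linearCombination R (id : M → M)))
  refine ⟨B.compl₁₂ s s, ?_⟩
  rw [LinearMap.BilinMap.toQuadraticMap_comp_same, hB]
  ext x
  simp only [QuadraticMap.comp_apply]
  rw [hs x]

/-- The base change `q_T` of a quadratic form `q` on a projective module `M` to an `R`-algebra `T`;
it does not require `2` to be invertible. By `baseChange_tmul` and `eq_baseChange` it is the unique
quadratic form on `T ⊗[R] M` such that `q_T (t ⊗ m) = q(m) t²`. -/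
def baseChange [Module.Projective R M] (T : Type w) [CommRing T] [Algebra R T]
    (q : QuadraticForm R M) : QuadraticForm T (T ⊗[R] M) :=
  LinearMap.BilinMap.toQuadraticMap
    (LinearMap.BilinForm.baseChange T (exists_bilinForm q).choose)

theorem baseChange_tmul [Module.Projective R M] (T : Type w) [CommRing T] [Algebra R T]
    (q : QuadraticForm R M) (t : T) (m : M) :
    baseChange T q (t ⊗ₜ[R] m) = algebraMap R T (q m) * t ^ 2 := by
  have h : (exists_bilinForm q).choose m m = q m :=
    congrArg (fun Q : QuadraticForm R M => Q m) (exists_bilinForm q).choose_spec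
  rw [baseChange, LinearMap.BilinMap.toQuadraticMap_apply,
    LinearMap.BilinForm.baseChange_tmul, h, Algebra.smul_def, pow_two]

theorem eq_baseChange [Module.Projective R M] (T : Type w) [CommRing T] [Algebra R T]
    (q : QuadraticForm R M) (Q : QuadraticForm T (T ⊗[R] M))
    (hQ : ∀ (m : M) (t : T), Q (t ⊗ₜ[R] m) = algebraMap R T (q m) * t ^ 2) :
    Q = baseChange T q := by
  apply baseChange_ext
  intro m
  rw [hQ, baseChange_tmul]

/-- A quadratic form `q` is nonsingular if `rad(q_F) = 0` for every field `F` that is an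
`R`-algebra, where `rad(Q) = {x | Q(x) = 0 and b_Q(x, y) = 0 for all y}`.

The fields range over the universe of `R`; this is no restriction, as it contains the algebraic
closures of all residue fields of `R`, and triviality of the radical over these implies triviality
over all fields. -/
def IsNonsingular [Module.Projective R M] (q : QuadraticForm R M) : Prop :=
  ∀ (F : Type u) [Field F] [Algebra R F], (baseChange F q).radical = ⊥

/-- A quadratic form `q` is regular if the adjoint `M → M^*`, `m ↦ b_q(m, -)`, of its polar form
`b_q(m, m') = q(m + m') - q(m) - q(m')` is bijective. -/
def IsRegular (q : QuadraticForm R M) : Prop :=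
  Function.Bijective (q.polarBilin : M → Module.Dual R M)

end BaseChange

end LGQuadratic

end

/-!
The form `q₃ ⊥ -q₃` is hyperbolic (`IsRegular.prod_neg_equivalent_dualProd`), and a hyperbolic form
on a finitely generated projective module is an orthogonal summand of a sum of hyperbolic planes
(`exists_dualProd_prod_equivalent`). So it is enough to cancel one hyperbolic plane `ℍ` at a time.

An isometry `q₁ ⊥ ℍ ≅ q₂ ⊥ ℍ` gives two hyperbolic pairs `(e, f)` and `(e', f')` in `V = q₁ ⊥ ℍ`
with complements `q₁` and `q₂`. If `e` is singular and `b(e, f)` is a unit, then `{e, f}^⊥` is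
isometric to `e^⊥ / Re`, whence it does not change if `f` is replaced by any `f'` such that
`b(e, f')` is a unit (`perpForm_equivalent_of_isUnit_polar`). Hence the two complements are
isometric as soon as some singular vector `v` pairs to a unit with both `e` and `e'`
(`perpForm_equivalent_of_link`).

The vectors `v = (w, f - q₁(w) e)` are singular with `b(v, e) = 1`, and for `e' = (x, c f + a e)` the
value `b(v, e') = a + b(x, w) - c q₁(w)` is a polynomial function of `w`. By the LG property
(`IsLGRing.exists_isUnit_quadratic`) it represents a unit if it is nonzero at each residue field.
Nonsingularity of `q₁` ensures this where the module of `q₁` has positive rank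
(`IsResiduallyNonsingular.exists_notMem`). Where the rank is zero, `V` is the hyperbolic plane and
the value may vanish identically. That locus is cut out by an idempotent `ε`
(`exists_isIdempotentElem_smul_eq_zero`), which also kills the module of `q₂`; replacing the isometry
by the identity of `ℍ` on the `ε`-component (`exists_isometryEquiv_smul_symm_eq`) makes `e'` equal to
`e` there, where the value is then `1`.
-/

noncomputable section

namespace LGQuadratic

open QuadraticMap QuadraticForm

/-! ### Complements of hyperbolic pairs -/

section Perp

variable {R V : Type*} [CommRing R] [AddCommGroup V] [Module R V]

/-- The orthogonal complement, for the polar form, of a pair of vectors. -/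
def pairPerp (Q : QuadraticForm R V) (x y : V) : Submodule R V :=
  LinearMap.ker (Q.polarBilin x) ⊓ LinearMap.ker (Q.polarBilin y)

/-- The form induced by `Q` on the orthogonal complement of a pair of vectors. -/
def perpForm (Q : QuadraticForm R V) (x y : V) : QuadraticForm R (pairPerp Q x y) :=
  Q.comp (pairPerp Q x y).subtype

theorem mem_pairPerp {Q : QuadraticForm R V} {x y z : V} :
    z ∈ pairPerp Q x y ↔ polar Q x z = 0 ∧ polar Q y z = 0 := by
  simp [pairPerp]

theorem perpForm_comm (Q : QuadraticForm R V) (x y : V) :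
    (perpForm Q x y).Equivalent (perpForm Q y x) :=
  ⟨{ LinearEquiv.ofEq _ _ (inf_comm _ _) with map_app' := fun _ => rfl }⟩

/-- The projection along a singular vector `e` from `{e, f}^⊥` to `{e, f'}^⊥`. -/
def perpMap (Q : QuadraticForm R V) {e f f' : V} (he : Q e = 0) (h : IsUnit (polar Q e f')) :
    pairPerp Q e f →ₗ[R] pairPerp Q e f' :=
  LinearMap.codRestrict _
    ((LinearMap.id - (Q.polarBilin f').smulRight ((↑h.unit⁻¹ : R) • e)) ∘ₗ
      (pairPerp Q e f).subtype) <| by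
    rintro ⟨x, hx⟩
    rw [mem_pairPerp] at hx
    have hee : polar Q e e = 0 := by rw [polar_self, he, smul_zero]
    have hu : (↑h.unit⁻¹ : R) * polar Q f' e = 1 := by
      rw [polar_comm Q f' e]; exact h.val_inv_mul
    rw [mem_pairPerp]
    constructor
    · simp [polar_sub_right, polar_smul_right, hx.1, hee]
    · simp [polar_sub_right, polar_smul_right, hu]

theorem perpMap_apply (Q : QuadraticForm R V) {e f f' : V} (he : Q e = 0)
    (h : IsUnit (polar Q e f')) (x : pairPerp Q e f) :
    (perpMap Q he h x : V) = x - (polar Q f' x * (↑h.unit⁻¹ : R)) • e := by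
  simp [perpMap, mul_smul]

theorem perpMap_perpMap (Q : QuadraticForm R V) {e f f' : V} (he : Q e = 0)
    (h : IsUnit (polar Q e f)) (h' : IsUnit (polar Q e f')) (x : pairPerp Q e f) :
    perpMap Q (f := f') he h (perpMap Q he h' x) = x := by
  have hx := mem_pairPerp.1 x.2
  have hu : polar Q f e * (↑h.unit⁻¹ : R) = 1 := by
    rw [polar_comm Q f e]; exact h.mul_val_inv
  ext
  rw [perpMap_apply, perpMap_apply, polar_sub_right, polar_smul_right, hx.2, smul_eq_mul,
    zero_sub, neg_mul, mul_assoc, hu]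
  simp

/-- The complement of a pair `{e, f}` with `e` singular and `b(e, f)` a unit is isometric to
`e^⊥ / Re`; in particular its isometry class does not depend on `f`. -/
theorem perpForm_equivalent_of_isUnit_polar (Q : QuadraticForm R V) {e f f' : V} (he : Q e = 0)
    (h : IsUnit (polar Q e f)) (h' : IsUnit (polar Q e f')) :
    (perpForm Q e f).Equivalent (perpForm Q e f') := by
  let E : pairPerp Q e f ≃ₗ[R] pairPerp Q e f' :=
    LinearEquiv.ofLinearMap (perpMap Q he h') (perpMap Q he h)
      (LinearMap.ext fun x => perpMap_perpMap Q he h' h x)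
      (LinearMap.ext fun x => perpMap_perpMap Q he h h' x)
  refine ⟨{ E with map_app' := fun x => ?_ }⟩
  have hx := (mem_pairPerp.1 x.2).1
  change Q (perpMap Q he h' x) = Q x
  rw [perpMap_apply, sub_eq_add_neg, ← neg_smul, QuadraticMap.map_add Q, QuadraticMap.map_smul, he,
    polar_smul_right, polar_comm Q x e, hx]
  simp

/-- Complements of hyperbolic pairs are isometric if their singular vectors `e` and `e'` are linked
by a singular vector `v` that pairs to a unit with both. -/
theorem perpForm_equivalent_of_link (Q : QuadraticForm R V) {e f v e' f' : V} (he : Q e = 0)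
    (hv : Q v = 0) (he' : Q e' = 0) (hfe : IsUnit (polar Q f e)) (hve : IsUnit (polar Q v e))
    (hve' : IsUnit (polar Q v e')) (hfe' : IsUnit (polar Q f' e')) :
    (perpForm Q f e).Equivalent (perpForm Q f' e') := by
  have h₁ := perpForm_equivalent_of_isUnit_polar Q he (polar_comm Q f e ▸ hfe)
    (polar_comm Q v e ▸ hve)
  have h₂ := perpForm_equivalent_of_isUnit_polar Q hv hve hve'
  have h₃ := perpForm_equivalent_of_isUnit_polar Q he' (polar_comm Q v e' ▸ hve')
    (polar_comm Q f' e' ▸ hfe')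
  exact (perpForm_comm Q f e).trans <| h₁.trans <| (perpForm_comm Q e v).trans <| h₂.trans <|
    (perpForm_comm Q v e').trans <| h₃.trans (perpForm_comm Q e' f')

end Perp

/-! ### Hyperbolic forms -/

section Hyperbolic

variable {R M V : Type*} [CommRing R] [AddCommGroup M] [Module R M] [AddCommGroup V] [Module R V]

theorem polar_dualProd (x y : Module.Dual R M × M) :
    polar (dualProd R M) x y = x.1 y.2 + y.1 x.2 := by
  simp [polar]; ring

/-- An isometry of `Q` with `q ⊥ ℍ`, `ℍ` the hyperbolic plane, identifies `q` with the complement of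
the hyperbolic pair that corresponds to the standard one. -/
theorem equivalent_perpForm_symm {Q : QuadraticForm R V} {q : QuadraticForm R M}
    (φ : Q.IsometryEquiv (q.prod (dualProd R R))) :
    q.Equivalent (perpForm Q (φ.symm (0, LinearMap.id, 0)) (φ.symm (0, 0, 1))) := by
  have hp (x y) : polar Q (φ.symm x) (φ.symm y) = polar (q.prod (dualProd R R)) x y := by
    simp only [polar, ← _root_.map_add, φ.symm.map_app]
  have hmem (x : M) : φ.symm (x, 0) ∈
      pairPerp Q (φ.symm (0, LinearMap.id, 0)) (φ.symm (0, 0, 1)) := by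
    rw [mem_pairPerp, hp, hp]
    simp [polar_prod]
  refine ⟨{ LinearEquiv.ofBijective (LinearMap.codRestrict _
    (φ.symm.toLinearEquiv.toLinearMap ∘ₗ LinearMap.inl R M (Module.Dual R R × R)) hmem)
      ⟨fun x y hxy => ?_, ?_⟩ with map_app' := fun x => ?_ }⟩
  · have := φ.symm.toLinearEquiv.injective (congrArg Subtype.val hxy)
    exact congrArg Prod.fst this
  · rintro ⟨z, hz⟩
    obtain ⟨⟨x, g, t⟩, rfl⟩ := φ.symm.toLinearEquiv.surjective z
    have hz' := mem_pairPerp.1 hz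
    rw [show φ.symm.toLinearEquiv (x, g, t) = φ.symm (x, g, t) from rfl, hp, hp] at hz'
    simp only [polar_prod, polar_dualProd, polar_zero_left] at hz'
    obtain ⟨ht, hg⟩ := hz'
    have ht : t = 0 := by simpa using ht
    have hg' : g = 0 := by ext; simpa using hg
    subst ht hg'
    exact ⟨x, rfl⟩
  · change Q (φ.symm (x, 0)) = q x
    rw [φ.symm.map_app]
    simp

/-- `q ⊥ -q` is hyperbolic when `q` is regular: a bilinear form `B` with `B(x, x) = q(x)` corrects
the Lagrangian complement of the diagonal, so that no division by `2` is needed. -/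
theorem IsRegular.prod_neg_equivalent_dualProd [Module.Projective R M] {q : QuadraticForm R M}
    (hq : IsRegular q) : (q.prod (-q)).Equivalent (dualProd R M) := by
  obtain ⟨B, rfl⟩ := exists_bilinForm q
  set q := LinearMap.BilinMap.toQuadraticMap B with hqdef
  let β : M ≃ₗ[R] Module.Dual R M := LinearEquiv.ofBijective q.polarBilin hq
  have hβ (x y) : β x y = polar q x y := rfl
  let F : (M × M) →ₗ[R] (Module.Dual R M × M) :=
    LinearMap.prod (B ∘ₗ (LinearMap.fst R M M - LinearMap.snd R M M) +
      β.toLinearMap ∘ₗ LinearMap.snd R M M) (LinearMap.fst R M M - LinearMap.snd R M M)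
  have hF (x y) : F (x, y) = (B (x - y) + β y, x - y) := rfl
  refine ⟨{ LinearEquiv.ofBijective F ⟨?_, ?_⟩ with map_app' := ?_ }⟩
  · rw [← LinearMap.ker_eq_bot, LinearMap.ker_eq_bot']
    rintro ⟨x, y⟩ h
    rw [hF, Prod.mk_eq_zero] at h
    obtain ⟨h1, h2⟩ := h
    rw [h2, _root_.map_zero, zero_add] at h1
    have hy := (map_eq_zero_iff β β.injective).1 h1
    subst hy
    simpa using h2
  · rintro ⟨g, z⟩
    refine ⟨(β.symm (g - B z) + z, β.symm (g - B z)), ?_⟩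
    rw [hF]
    simp
  · rintro ⟨x, y⟩
    change dualProd R M (F (x, y)) = _
    rw [hF]
    simp [hβ, polar, hqdef]
    ring

/-- A finitely generated projective module is a direct summand of some `R^n`; the complement of
`dualProd R M` in `dualProd R (R^n)` is again of this kind. -/
theorem exists_dualProd_prod_equivalent (R M : Type*) [CommRing R] [AddCommGroup M] [Module R M]
    [Module.Finite R M] [Module.Projective R M] :
    ∃ (n : ℕ) (N : Submodule R (Fin n → R)),
      ((dualProd R M).prod (dualProd R N)).Equivalent (dualProd R (Fin n → R)) := by
  obtain ⟨n, f, g, -, -, hfg⟩ := Module.Finite.exists_comp_eq_id_of_projective R M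
  have hfg' (m : M) : f (g m) = m := DFunLike.congr_fun hfg m
  let E : (M × LinearMap.ker f) ≃ₗ[R] (Fin n → R) :=
    LinearEquiv.ofBijective (g.coprod (LinearMap.ker f).subtype) <| by
      refine ⟨?_, fun x => ⟨(f x, ⟨x - g (f x), ?_⟩), ?_⟩⟩
      · rw [← LinearMap.ker_eq_bot, LinearMap.ker_eq_bot']
        rintro ⟨m, k, hk⟩ h
        rw [LinearMap.coprod_apply, Submodule.subtype_apply] at h
        have hm : m = 0 := by
          simpa [hfg', LinearMap.mem_ker.1 hk] using congrArg f h
        subst hm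
        simpa using h
      · simp [hfg']
      · simp
  exact ⟨n, LinearMap.ker f, ⟨dualProdProdIsometry.symm.trans (dualProdIsometry E)⟩⟩

end Hyperbolic

/-! ### Nonsingularity at the residue fields -/

section Residue

variable {R M : Type*} [CommRing R] [AddCommGroup M] [Module R M]

/-- Triviality of the radical over the residue fields `R ⧸ 𝔪`, phrased without base change. -/
def IsResiduallyNonsingular (q : QuadraticForm R M) : Prop :=
  ∀ (m : Ideal R) [m.IsMaximal] (x : M), q x ∈ m → (∀ y, polar q x y ∈ m) →
    x ∈ m • (⊤ : Submodule R M)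

theorem polar_baseChange_tmul [Module.Projective R M] (T : Type*) [CommRing T] [Algebra R T]
    (q : QuadraticForm R M) (s t : T) (x y : M) :
    polar (baseChange T q) (s ⊗ₜ[R] x) (t ⊗ₜ[R] y) = s * t * algebraMap R T (polar q x y) := by
  obtain ⟨B, hB⟩ : ∃ B, B = (exists_bilinForm q).choose := ⟨_, rfl⟩
  have hq : LinearMap.BilinMap.toQuadraticMap B = q := hB ▸ (exists_bilinForm q).choose_spec
  rw [baseChange, ← hB, ← hq]
  simp only [LinearMap.BilinMap.polar_toQuadraticMap, LinearMap.BilinForm.baseChange_tmul,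
    Algebra.smul_def, _root_.map_add]
  ring

theorem IsNonsingular.isResiduallyNonsingular {R : Type u} {M : Type v} [CommRing R]
    [AddCommGroup M] [Module R M] [Module.Projective R M] {q : QuadraticForm R M}
    (hq : IsNonsingular q) : IsResiduallyNonsingular q := by
  intro m hm x hx hxy
  let _ : Field (R ⧸ m) := Ideal.Quotient.field m
  have hmk {r : R} (hr : r ∈ m) : algebraMap R (R ⧸ m) r = 0 :=
    Ideal.Quotient.eq_zero_iff_mem.2 hr
  have hrad : (1 : R ⧸ m) ⊗ₜ[R] x ∈ (baseChange (R ⧸ m) q).radical := by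
    refine ⟨by rw [baseChange_tmul, hmk hx, zero_mul], LinearMap.ext fun z => ?_⟩
    induction z using TensorProduct.induction_on with
    | zero => simp
    | tmul t y =>
      rw [polarBilin_apply_apply, polar_baseChange_tmul, hmk (hxy y), mul_zero,
        LinearMap.zero_apply]
    | add a b ha hb => rw [_root_.map_add, ha, hb, _root_.map_add]
  rw [hq (R ⧸ m), Submodule.mem_bot] at hrad
  have := congrArg (TensorProduct.quotTensorEquivQuotSMul M m) hrad
  rw [_root_.map_zero, ← _root_.map_one (Ideal.Quotient.mk m),
    TensorProduct.quotTensorEquivQuotSMul_mk_tmul, one_smul] at this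
  exact (Submodule.Quotient.mk_eq_zero _).1 this

theorem map_mem_smul_top {N : Type*} [AddCommGroup N] [Module R N] {m : Ideal R} {x : M}
    (hx : x ∈ m • (⊤ : Submodule R M)) (f : M →ₗ[R] N) : f x ∈ m • (⊤ : Submodule R N) :=
  Submodule.smul_mono le_rfl le_top (Submodule.map_smul'' m ⊤ f ▸ Submodule.mem_map_of_mem hx)

theorem apply_mem_of_mem_smul_top {m : Ideal R} {x : M} (hx : x ∈ m • (⊤ : Submodule R M))
    (f : Module.Dual R M) : f x ∈ m := by
  simpa using map_mem_smul_top hx f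

/-- The condition on `q'` holds for every form that is regular modulo all maximal ideals. -/
theorem IsResiduallyNonsingular.prod {N : Type*} [AddCommGroup N] [Module R N]
    {q : QuadraticForm R M} {q' : QuadraticForm R N} (hq : IsResiduallyNonsingular q)
    (hq' : ∀ (m : Ideal R) [m.IsMaximal] (x : N), (∀ y, polar q' x y ∈ m) →
      x ∈ m • (⊤ : Submodule R N) ∧ q' x ∈ m) :
    IsResiduallyNonsingular (q.prod q') := by
  rintro m hm ⟨x, x'⟩ hx hxy
  obtain ⟨hx', hqx'⟩ := hq' m x' fun y => by simpa [polar_prod] using hxy (0, y)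
  have hx₀ := hq m x ((m.add_mem_iff_left hqx').1 (by simpa using hx)) fun y => by
    simpa [polar_prod] using hxy (y, 0)
  simpa using add_mem (map_mem_smul_top hx₀ (LinearMap.inl R M N))
    (map_mem_smul_top hx' (LinearMap.inr R M N))

theorem IsResiduallyNonsingular.prod_dualProd {q : QuadraticForm R M}
    (hq : IsResiduallyNonsingular q) (n : ℕ) :
    IsResiduallyNonsingular (q.prod (dualProd R (Fin n → R))) := by
  refine hq.prod fun m _ => ?_
  rintro ⟨g, t⟩ h
  have ht (i : Fin n) : t i ∈ m := by simpa [polar] using h (LinearMap.proj i, 0)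
  have hg (i : Fin n) : g (Pi.single i 1) ∈ m := by simpa [polar] using h (0, Pi.single i 1)
  have ht' : t ∈ m • (⊤ : Submodule R (Fin n → R)) := by
    rw [← Finset.univ_sum_single t]
    refine Submodule.sum_mem _ fun i _ => ?_
    rw [← mul_one (t i), ← smul_eq_mul, Pi.single_smul]
    exact Submodule.smul_mem_smul (ht i) trivial
  have hg' : g ∈ m • (⊤ : Submodule R (Module.Dual R (Fin n → R))) := by
    have : g = ∑ i, g (Pi.single i 1) • LinearMap.proj i := by
      ext i
      simp [Pi.single_apply]
    rw [this]
    exact Submodule.sum_mem _ fun i _ => Submodule.smul_mem_smul (hg i) trivial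
  refine ⟨?_, apply_mem_of_mem_smul_top ht' g⟩
  simpa using add_mem (map_mem_smul_top hg' (LinearMap.inl R _ (Fin n → R)))
    (map_mem_smul_top ht' (LinearMap.inr R (Module.Dual R (Fin n → R)) _))

end Residue

/-! ### Unit values of quadratic polynomials over an LG-ring -/

section LocalGlobal

variable {R M : Type*} [CommRing R] [AddCommGroup M] [Module R M]

/-- A polynomial function of degree at most two on a finitely generated projective module over an
LG-ring that is nonzero at every residue field takes a unit value. -/
theorem IsLGRing.exists_isUnit_quadratic (hR : IsLGRing R) [Module.Finite R M]
    [Module.Projective R M] (q : QuadraticForm R M) (f : Module.Dual R M) (a c : R)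
    (h : ∀ (m : Ideal R) [m.IsMaximal], ∃ w, a + f w - c * q w ∉ m) :
    ∃ w, IsUnit (a + f w - c * q w) := by
  obtain ⟨B, rfl⟩ := exists_bilinForm q
  obtain ⟨n, p, hp⟩ := Module.Finite.exists_fin' R M
  let g (i : Fin n) : M := p fun j => if i = j then 1 else 0
  have hg (s : Fin n → R) : p s = ∑ i, s i • g i := p.pi_apply_eq_sum_univ s
  let P : MvPolynomial (Fin n) R := MvPolynomial.C a +
    ∑ i, MvPolynomial.C (f (g i)) * MvPolynomial.X i -
      MvPolynomial.C c * ∑ i, ∑ j, MvPolynomial.C (B (g i) (g j)) *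
        (MvPolynomial.X i * MvPolynomial.X j)
  have hP (s : Fin n → R) : MvPolynomial.aeval s P =
      a + f (p s) - c * LinearMap.BilinMap.toQuadraticMap B (p s) := by
    simp only [P, hg, _root_.map_add, map_sub, map_sum, _root_.map_mul, MvPolynomial.aeval_X,
      MvPolynomial.aeval_C, Algebra.algebraMap_self, RingHom.id_apply, _root_.map_smul,
      smul_eq_mul, LinearMap.BilinMap.toQuadraticMap_apply, LinearMap.sum_apply,
      LinearMap.smul_apply]
    congr 2
    · exact congrArg _ (funext fun i => mul_comm _ _)
    · rw [Finset.sum_comm]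
      refine Finset.sum_congr rfl fun i _ => ?_
      rw [Finset.mul_sum]
      exact Finset.sum_congr rfl fun j _ => by ring
  obtain ⟨s, hs⟩ := (hR n P).2 fun m hm => by
    obtain ⟨w, hw⟩ := h m
    obtain ⟨s, rfl⟩ := hp w
    let _ : Field (R ⧸ m) := Ideal.Quotient.field m
    refine ⟨fun i => algebraMap R (R ⧸ m) (s i), IsUnit.mk0 _ fun h0 => hw ?_⟩
    rw [← hP, ← Ideal.Quotient.eq_zero_iff_mem]
    exact (MvPolynomial.aeval_algebraMap_apply (R ⧸ m) s P).symm.trans h0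
  exact ⟨p s, hP s ▸ hs⟩

/-- For a singular vector `(x, c, a)` of `q ⊥ ℍ` that is nonzero at `R ⧸ 𝔪`, its pairings
`a + b(x, w) - c q(w)` with the singular vectors `(w, 1, -q(w))` do not all vanish modulo `𝔪`, unless
the module and `a` both do. -/
theorem IsResiduallyNonsingular.exists_notMem {q : QuadraticForm R M}
    (hq : IsResiduallyNonsingular q) {m : Ideal R} [hm : m.IsMaximal] {a c : R} {x : M}
    (h0 : q x + c * a = 0) (hu : ¬ (a ∈ m ∧ c ∈ m ∧ x ∈ m • (⊤ : Submodule R M)))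
    (ha : m • (⊤ : Submodule R M) = ⊤ → a ∉ m) :
    ∃ w, a + q.polarBilin x w - c * q w ∉ m := by
  by_contra! H
  have ham : a ∈ m := by simpa using H 0
  have H' (w : M) : polar q x w - c * q w ∈ m := by
    have := m.sub_mem (H w) ham
    rwa [add_sub_assoc, add_sub_cancel_left] at this
  by_cases hc : c ∈ m
  · refine hu ⟨ham, hc, hq m x ?_ fun w => ?_⟩
    · rw [eq_neg_of_add_eq_zero_left h0]
      exact m.neg_mem (m.mul_mem_left _ ham)
    · simpa using m.add_mem (H' w) (m.mul_mem_right (q w) hc)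
  · -- The form `c q` is congruent to a linear form, so `q` has trivial polar form modulo `𝔪`.
    have hb (w y : M) : polar q w y ∈ m := by
      refine (hm.isPrime.mem_or_mem (x := c) ?_).resolve_left hc
      have := m.sub_mem (m.sub_mem (H' w) (H' (w + y))) (m.neg_mem (H' y))
      convert this using 1
      rw [polar_add_right, QuadraticMap.map_add q w y]
      ring
    refine ha (eq_top_iff.2 fun w _ => hq m w ?_ (hb w)) ham
    refine (hm.isPrime.mem_or_mem (x := c) ?_).resolve_left hc
    simpa using m.sub_mem (hb x w) (H' w)

end LocalGlobal

/-! ### The locus of rank zero -/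

section Twist

variable {R M : Type*} [CommRing R] [AddCommGroup M] [Module R M]

/-- The annihilator of a finitely generated projective module is generated by an idempotent, which
therefore avoids all maximal ideals at which the module vanishes. -/
theorem exists_isIdempotentElem_smul_eq_zero (R M : Type*) [CommRing R] [AddCommGroup M]
    [Module R M] [Module.Finite R M] [Module.Projective R M] :
    ∃ ε : R, IsIdempotentElem ε ∧ (∀ x : M, ε • x = 0) ∧
      ∀ m : Ideal R, m.IsMaximal → m • (⊤ : Submodule R M) = ⊤ → ε ∉ m := by
  obtain ⟨n, f, g, -, -, hfg⟩ := Module.Finite.exists_comp_eq_id_of_projective R M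
  have hfg' (x : M) : f (g x) = x := DFunLike.congr_fun hfg x
  -- The trace ideal, spanned by the coordinates of the embedding `g`.
  let T : Ideal R := Ideal.span {r | ∃ x i, r = g x i}
  have hT : (⊤ : Submodule R M) ≤ T • ⊤ := fun x _ => by
    rw [← hfg' x, f.pi_apply_eq_sum_univ]
    exact Submodule.sum_mem _ fun i _ =>
      Submodule.smul_mem_smul (Ideal.subset_span ⟨x, i, rfl⟩) trivial
  have hann {r : R} (hr : ∀ x : M, r • x = 0) {t : R} (ht : t ∈ T) : r * t = 0 := by
    induction ht using Submodule.span_induction with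
    | mem t h =>
      obtain ⟨x, i, rfl⟩ := h
      rw [← smul_eq_mul, ← Pi.smul_apply, ← _root_.map_smul, hr, _root_.map_zero, Pi.zero_apply]
    | zero => simp
    | add a b _ _ ha hb => rw [mul_add, ha, hb, add_zero]
    | smul a b _ hb => rw [smul_eq_mul, mul_left_comm, hb, mul_zero]
  obtain ⟨ε, hε, hεM⟩ := Submodule.exists_sub_one_mem_and_smul_eq_zero_of_fg_of_le_smul T ⊤
    Module.Finite.fg_top hT
  have hεM (x : M) : ε • x = 0 := hεM x trivial
  refine ⟨ε, ?_, hεM, fun m hm h hmem => ?_⟩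
  · have := hann hεM hε
    rwa [mul_sub, mul_one, sub_eq_zero] at this
  · obtain ⟨r, hr, hrM⟩ := Submodule.exists_sub_one_mem_and_smul_eq_zero_of_fg_of_le_smul m ⊤
      (Module.Finite.fg_top (R := R) (M := M)) h.ge
    have := hann (fun x => hrM x trivial) hε
    rw [mul_sub, mul_one, sub_eq_zero] at this
    refine hm.ne_top ((Ideal.eq_top_iff_one _).2 ?_)
    have h1 := m.sub_mem (this ▸ m.mul_mem_left r hmem) hr
    rwa [sub_sub_cancel] at h1

variable {M' N : Type*} [AddCommGroup M'] [Module R M'] [AddCommGroup N] [Module R N]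

/-- Stably isomorphic modules are killed by the same idempotents: over the `ε`-component `N` is
isomorphic to `M' × N`, and a surjective endomorphism of a finitely generated module is injective. -/
theorem smul_eq_zero_of_prod_equiv [Module.Finite R N] (φ : (M × N) ≃ₗ[R] (M' × N)) {ε : R}
    (hε : IsIdempotentElem ε) (h : ∀ x : M, ε • x = 0) (y : M') : ε • y = 0 := by
  have hφ (p : M × N) : φ (0, ε • p.2) = ε • φ p := by
    rw [← _root_.map_smul, ← h p.1]
    rfl
  -- This endomorphism of `N` is `pr ∘ φ` on `εN` and the identity on `(1 - ε)N`.
  let T : N →ₗ[R] N := ε • (LinearMap.snd R M' N ∘ₗ φ.toLinearMap ∘ₗ LinearMap.inr R M N) +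
    (1 - ε) • LinearMap.id
  have hT (z : N) : T z = (φ (0, ε • z)).2 + (1 - ε) • z := by
    rw [hφ (0, z)]
    rfl
  have hε' : (1 - ε) * ε = 0 := hε.one_sub_mul_self
  have hTε (p : M × N) : T (ε • p.2) = ε • (φ p).2 := by
    rw [hT, smul_smul, hε.eq, hφ, smul_smul, hε', zero_smul, add_zero]
    rfl
  have hTs : Function.Surjective T := fun z => by
    refine ⟨ε • (φ.symm (0, z)).2 + (1 - ε) • z, ?_⟩
    rw [_root_.map_add, hTε, hT, smul_smul, mul_comm, hε', smul_smul, hε.one_sub.eq,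
      φ.apply_symm_apply, zero_smul]
    change ε • z + ((φ 0).2 + (1 - ε) • z) = z
    rw [_root_.map_zero, Prod.snd_zero, zero_add, ← add_smul, add_sub_cancel, one_smul]
  have hTi := OrzechProperty.injective_of_surjective_endomorphism T hTs
  have hz : ε • (φ.symm (y, 0)).2 = 0 := hTi <| by
    rw [hTε, φ.apply_symm_apply, smul_zero, _root_.map_zero]
  have := hφ (φ.symm (y, 0))
  rw [hz, φ.apply_symm_apply] at this
  exact (congrArg Prod.fst (this.symm.trans (_root_.map_zero φ)))

/-- The map `(1 - ε) φ + ε pr`, where `pr` is the projection to `N`. -/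
def idempotentTwist (φ : (M × N) →ₗ[R] (M' × N)) (ε : R) : (M × N) →ₗ[R] (M' × N) :=
  (1 - ε) • φ + ε • (LinearMap.inr R M' N ∘ₗ LinearMap.snd R M N)

theorem idempotentTwist_apply (φ : (M × N) →ₗ[R] (M' × N)) (ε : R) (x : M × N) :
    idempotentTwist φ ε x = (1 - ε) • φ x + ε • (0, x.2) :=
  rfl

theorem smul_idempotentTwist (φ : (M × N) →ₗ[R] (M' × N)) {ε : R} (hε : IsIdempotentElem ε)
    (x : M × N) : ε • idempotentTwist φ ε x = ε • (0, x.2) := by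
  rw [idempotentTwist_apply, smul_add, smul_smul, smul_smul, hε.mul_one_sub_self, hε.eq,
    zero_smul, zero_add]

theorem idempotentTwist_idempotentTwist {φ : (M × N) →ₗ[R] (M' × N)}
    {ψ : (M' × N) →ₗ[R] (M × N)} (hφψ : ∀ x, φ (ψ x) = x) {ε : R} (hε : IsIdempotentElem ε)
    (h : ∀ x : M', ε • x = 0) (x : M' × N) :
    idempotentTwist φ ε (idempotentTwist ψ ε x) = x := by
  have h₁ : ε • ((0 : M'), (idempotentTwist ψ ε x).2) = ε • x := by
    have := congrArg Prod.snd (smul_idempotentTwist ψ hε x)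
    refine Prod.ext ?_ this
    simp [h]
  have h₂ : (1 - ε) • φ (idempotentTwist ψ ε x) = (1 - ε) • x := by
    rw [idempotentTwist_apply, _root_.map_add, _root_.map_smul, _root_.map_smul, hφψ, smul_add,
      smul_smul, smul_smul, hε.one_sub_mul_self, hε.one_sub.eq, zero_smul, add_zero]
  rw [idempotentTwist_apply, h₁, h₂, ← add_smul, sub_add_cancel, one_smul]

/-- If the idempotent `ε` kills `M` and `M'`, an isometry `q ⊥ Q ≅ q' ⊥ Q` may be replaced by the
identity of `Q` on the `ε`-component. -/
theorem exists_isometryEquiv_smul_symm_eq {q : QuadraticForm R M} {q' : QuadraticForm R M'}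
    {Q : QuadraticForm R N} (φ : (q.prod Q).IsometryEquiv (q'.prod Q)) {ε : R}
    (hε : IsIdempotentElem ε) (h : ∀ x : M, ε • x = 0) (h' : ∀ x : M', ε • x = 0) :
    ∃ ψ : (q.prod Q).IsometryEquiv (q'.prod Q), ∀ z, ε • ψ.symm (0, z) = ε • (0, z) := by
  let F := idempotentTwist φ.toLinearEquiv.toLinearMap ε
  let G := idempotentTwist φ.symm.toLinearEquiv.toLinearMap ε
  let E : (M × N) ≃ₗ[R] (M' × N) := LinearEquiv.ofLinearMap F G
    (LinearMap.ext (idempotentTwist_idempotentTwist φ.apply_symm_apply hε h'))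
    (LinearMap.ext (idempotentTwist_idempotentTwist φ.symm_apply_apply hε h))
  refine ⟨{ E with map_app' := fun x => ?_ }, fun z => smul_idempotentTwist _ hε (0, z)⟩
  change (q'.prod Q) ((1 - ε) • φ x + ε • (0, x.2)) = _
  have hq : ε * q x.1 = 0 := by
    rw [← hε.eq, ← smul_eq_mul, ← QuadraticMap.map_smul, h, QuadraticMap.map_zero]
  rw [QuadraticMap.map_add (q'.prod Q), QuadraticMap.map_smul, QuadraticMap.map_smul, φ.map_app,
    polar_smul_left, polar_smul_right, smul_smul, hε.one_sub_mul_self, zero_smul, hε.eq,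
    hε.one_sub.eq]
  simp only [QuadraticMap.prod_apply, QuadraticMap.map_zero, smul_eq_mul]
  linear_combination -hq

end Twist

/-! ### Cancellation of hyperbolic planes -/

section Cancellation

variable {R M₁ M₂ : Type*} [CommRing R] [AddCommGroup M₁] [Module R M₁] [AddCommGroup M₂]
  [Module R M₂]

/-- Cancellation of one hyperbolic plane. -/
theorem IsResiduallyNonsingular.cancel_hyperbolicPlane [Module.Finite R M₁]
    [Module.Projective R M₁] (hR : IsLGRing R)
    {q₁ : QuadraticForm R M₁} {q₂ : QuadraticForm R M₂} (hq : IsResiduallyNonsingular q₁)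
    (h : (q₁.prod (dualProd R R)).Equivalent (q₂.prod (dualProd R R))) : q₁.Equivalent q₂ := by
  obtain ⟨φ⟩ := h
  obtain ⟨ε, hε, hε₁, hεm⟩ := exists_isIdempotentElem_smul_eq_zero R M₁
  have hε₂ := smul_eq_zero_of_prod_equiv φ.toLinearEquiv hε hε₁
  obtain ⟨ψ, hψ⟩ := exists_isometryEquiv_smul_symm_eq φ hε hε₁ hε₂
  have hp (y z) : polar (q₁.prod (dualProd R R)) (ψ.symm y) (ψ.symm z) =
      polar (q₂.prod (dualProd R R)) y z := by
    simp only [polar, ← _root_.map_add, ψ.symm.map_app]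
  have hg (g : Module.Dual R R) (t : R) : g t = t * g 1 := by
    rw [← smul_eq_mul, ← _root_.map_smul, smul_eq_mul, mul_one]
  obtain ⟨x, g, a, he'⟩ : ∃ x g a, ψ.symm (0, 0, 1) = (x, g, a) := ⟨_, _, _, rfl⟩
  obtain ⟨x', g', a', hf'⟩ : ∃ x g a, ψ.symm (0, LinearMap.id, 0) = (x, g, a) := ⟨_, _, _, rfl⟩
  have hQe' : (q₁.prod (dualProd R R)) (x, g, a) = 0 := by
    rw [← he', ψ.symm.map_app]
    simp
  have hpe' : polar (q₁.prod (dualProd R R)) (x', g', a') (x, g, a) = 1 := by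
    rw [← he', ← hf', hp]
    simp [polar]
  have hεa : ε * a = ε := by
    have := congrArg (fun p => p.2.2) (hψ (0, 1))
    rw [he'] at this
    simpa using this
  obtain ⟨w, hw⟩ := hR.exists_isUnit_quadratic q₁ (q₁.polarBilin x) a (g 1) fun m hm => by
    refine hq.exists_notMem ?_ ?_ fun htop ha => hεm m hm htop ?_
    · rw [← hQe', prod_apply, dualProd_apply, hg g a, mul_comm]
    · rintro ⟨ha, hc, hx⟩
      refine hm.ne_top ((Ideal.eq_top_iff_one _).2 ?_)
      rw [← hpe', polar_prod, polar_dualProd, hg g, hg g']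
      have := apply_mem_of_mem_smul_top hx (q₁.polarBilin x')
      exact m.add_mem this (m.add_mem (m.mul_mem_right _ ha) (m.mul_mem_left _ hc))
    · rw [← hεa]
      exact m.mul_mem_left _ ha
  have h₁ := equivalent_perpForm_symm (QuadraticMap.IsometryEquiv.refl (q₁.prod (dualProd R R)))
  have h₂ := equivalent_perpForm_symm ψ
  rw [he', hf'] at h₂
  -- With `e = (0, 0, 1)` and `e' = (x, g, a)`, the vector `v = (w, id, -q₁(w))` is singular,
  -- `b(v, e) = 1`, and `b(v, e')` is the unit found above.
  refine (h₁.trans ?_).trans h₂.symm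
  refine perpForm_equivalent_of_link _ (e := (0, 0, 1)) (f := (0, LinearMap.id, 0))
    (v := (w, LinearMap.id, -q₁ w)) ?_ ?_ hQe' ?_ ?_ ?_ ?_
  · simp
  · simp
  · simp [polar_prod, polar_dualProd]
  · simp [polar_prod, polar_dualProd]
  · rw [polar_prod, polar_dualProd, hg g]
    convert hw using 1
    simp only [LinearMap.id_apply, polarBilin_apply_apply, polar_comm q₁ x w]
    ring
  · rw [hpe']
    exact isUnit_one

theorem prod_assoc_equivalent {N P : Type*} [AddCommGroup N] [Module R N] [AddCommGroup P]
    [Module R P] (q : QuadraticForm R M₁) (q' : QuadraticForm R N) (q'' : QuadraticForm R P) :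
    ((q.prod q').prod q'').Equivalent (q.prod (q'.prod q'')) :=
  ⟨{ LinearEquiv.prodAssoc R M₁ N P with map_app' := fun _ => (add_assoc _ _ _).symm }⟩

theorem prod_equivalent_of_subsingleton {R M N : Type*} [CommRing R] [AddCommGroup M] [Module R M]
    [AddCommGroup N] [Module R N] [Subsingleton N] (q : QuadraticForm R M)
    (q' : QuadraticForm R N) : (q.prod q').Equivalent q := by
  let _ : Unique N := uniqueOfSubsingleton 0
  refine ⟨{ LinearEquiv.prodUnique (R := R) (M := M) (M₂ := N) with map_app' := ?_ }⟩
  rintro ⟨x, y⟩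
  rw [Subsingleton.elim y 0]
  simp

theorem dualProd_fin_succ_equivalent (R : Type*) [CommRing R] (n : ℕ) :
    (dualProd R (Fin (n + 1) → R)).Equivalent ((dualProd R (Fin n → R)).prod (dualProd R R)) :=
  ⟨(dualProdIsometry ((Fin.consLinearEquiv R fun _ => R).symm ≪≫ₗ
    LinearEquiv.prodComm R _ _)).trans dualProdProdIsometry⟩

theorem IsResiduallyNonsingular.cancel_dualProd [Module.Finite R M₁] [Module.Projective R M₁]
    (hR : IsLGRing R) {q₁ : QuadraticForm R M₁} {q₂ : QuadraticForm R M₂}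
    (hq : IsResiduallyNonsingular q₁) (n : ℕ)
    (h : (q₁.prod (dualProd R (Fin n → R))).Equivalent (q₂.prod (dualProd R (Fin n → R)))) :
    q₁.Equivalent q₂ := by
  induction n with
  | zero =>
    exact (prod_equivalent_of_subsingleton q₁ _).symm.trans <| h.trans <|
      prod_equivalent_of_subsingleton q₂ _
  | succ n ih =>
    have H := dualProd_fin_succ_equivalent R n
    refine ih <| (hq.prod_dualProd n).cancel_hyperbolicPlane hR ?_
    exact (prod_assoc_equivalent _ _ _).trans <| (Equivalent.prod (.refl q₁) H.symm).trans <|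
      h.trans <| (Equivalent.prod (.refl q₂) H).trans (prod_assoc_equivalent _ _ _).symm

end Cancellation

end LGQuadratic

end
theorem mainTheorem10 {R : Type*} [CommRing R] (hR : LGQuadratic.IsLGRing R)
    {M₁ M₂ M₃ : Type*}
    [AddCommGroup M₁] [Module R M₁] [Module.Finite R M₁] [Module.Projective R M₁]
    [AddCommGroup M₂] [Module R M₂] [Module.Finite R M₂] [Module.Projective R M₂]
    [AddCommGroup M₃] [Module R M₃] [Module.Finite R M₃] [Module.Projective R M₃]
    (q₁ : QuadraticForm R M₁) (q₂ : QuadraticForm R M₂) (q₃ : QuadraticForm R M₃)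
    (h₁ : LGQuadratic.IsNonsingular q₁) (h₂ : LGQuadratic.IsNonsingular q₂)
    (h₃ : LGQuadratic.IsRegular q₃)
    (h : QuadraticMap.Equivalent (QuadraticMap.prod q₁ q₃) (QuadraticMap.prod q₂ q₃)) :
    QuadraticMap.Equivalent q₁ q₂ := by
  obtain ⟨n, N, hN⟩ := LGQuadratic.exists_dualProd_prod_equivalent R M₃
  -- `q₃ ⊥ Q` is a sum of `n` hyperbolic planes.
  let Q := (-q₃).prod (QuadraticForm.dualProd R N)
  have hQ : (q₃.prod Q).Equivalent (QuadraticForm.dualProd R (Fin n → R)) :=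
    (LGQuadratic.prod_assoc_equivalent _ _ _).symm.trans <|
      (QuadraticMap.Equivalent.prod h₃.prod_neg_equivalent_dualProd (.refl _)).trans hN
  refine h₁.isResiduallyNonsingular.cancel_dualProd hR n ?_
  exact (QuadraticMap.Equivalent.prod (.refl q₁) hQ.symm).trans <|
    (LGQuadratic.prod_assoc_equivalent _ _ _).symm.trans <|
    (QuadraticMap.Equivalent.prod h (.refl Q)).trans <|
    (LGQuadratic.prod_assoc_equivalent _ _ _).trans <|
    QuadraticMap.Equivalent.prod (.refl q₂) hQ
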